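/- Let $R$ be a commutative Noetherian local ring that is Cohen--Macaulay, with residue field $k$. Let $\omega$ be a canonical module of $R$, that is, a finitely generated maximal Cohen--Macaulay $R$-module of finite injective dimension with $\dim_k \operatorname{Ext}_R^{d}(k,\omega)=1$, where $d=\operatorname{depth}_R\omega=\dim R$. Let $M$ and $N$ be nonzero finitely generated $R$-modules such that $M$ is maximal Cohen--Macaulay (that is, $\operatorname{depth}_R M=\dim M=\dim R$) and such that the tensor product $M\otimes_R N$ has finite injective dimension over $R$. Then there is a surjective $R$-module homomorphism $M^{\oplus \mu(N)}\to\omega$, where $\mu(N)$ denotes the minimal number of generators of $N$. -/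

import Mathlib

open scoped TensorProduct

universe u

namespace LocalCM

open CategoryTheory

noncomputable section

variable (R : Type u) [CommRing R] [IsLocalRing R] (M : Type u) [AddCommGroup M] [Module R M]

/-- The depth of a module over a local ring: the supremum of the lengths of the `M`-regular
sequences in the maximal ideal. For a nonzero finitely generated module, the requirement
`(x₁, …, xₙ) M ≠ M` of a regular sequence in the maximal ideal is automatic; for the zero module
this definition gives the usual convention `depth 0 = ∞`. -/
def depth : ℕ∞ :=
  ⨆ rs ∈ {rs : List R | (∀ r ∈ rs, r ∈ IsLocalRing.maximalIdeal R) ∧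
    RingTheory.Sequence.IsWeaklyRegular M rs}, (rs.length : ℕ∞)

/-- A finitely generated module is Cohen-Macaulay if it is zero or its depth equals its Krull
dimension. -/
structure IsCohenMacaulay : Prop where
  finite : Module.Finite R M
  depth_eq : Subsingleton M ∨ ((depth R M : ℕ∞) : WithBot ℕ∞) = Module.supportDim R M

/-- A maximal Cohen-Macaulay module: a Cohen-Macaulay module with `dim M = dim R`
(in particular it is nonzero). -/
structure IsMaximalCohenMacaulay : Prop extends IsCohenMacaulay R M where
  dim_eq : Module.supportDim R M = ringKrullDim R

/-- The (Cohen-Macaulay) type of `M`, that is `dim_k Ext^t(k, M)` with `t = depth M` and `k` the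
residue field. Since the maximal ideal annihilates this `Ext` module, its dimension over `k` is its
length over `R`. -/
def type : ℕ∞ :=
  Module.length R (Abelian.Ext (ModuleCat.of R (IsLocalRing.ResidueField R)) (ModuleCat.of R M)
    (depth R M).toNat)

/-- A canonical module: a maximal Cohen-Macaulay module of type one and of finite injective
dimension. -/
structure IsCanonicalModule : Prop extends IsMaximalCohenMacaulay R M where
  type_eq : type R M = 1
  injectiveDimension_lt : injectiveDimension (ModuleCat.of R M) < ⊤

end

/-- A Cohen-Macaulay local ring: a Noetherian local ring that is Cohen-Macaulay as a module over
itself. -/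
class IsCohenMacaulayLocalRing (R : Type u) [CommRing R] : Prop extends
    IsLocalRing R, IsNoetherianRing R where
  isCohenMacaulay : IsCohenMacaulay R R

/-- The minimal number of generators of a (finitely generated) module. -/
noncomputable def mu (R : Type u) [CommRing R] (N : Type u) [AddCommGroup N] [Module R N] : ℕ :=
  (⊤ : Submodule R N).spanFinrank

end LocalCM

/-!
The finite modules `G` with `Ext^i(G, ω) = 0` for all `i > 0` take the role of the maximal
Cohen-Macaulay modules. Modulo a maximal `ω`-regular sequence, `ω` becomes an injective module with
simple socle over an Artinian quotient of `R`. There, homomorphisms to `ω` separate points and every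
endomorphism of `ω` is a scalar. By Nakayama's lemma the second fact lifts to `ω` itself, and the
first lifts to every `G` as above, where `Ext¹(G, ω) = 0` provides the lifts of homomorphisms. Hence
`G` embeds into some `ω^n` with a cokernel of the same kind, and shifting degrees along such
embeddings gives `Ext^i(G, Y) = 0` for `i > 0` and every finite `Y` of finite injective dimension.

Let `X` be finite of finite injective dimension. Its Auslander-Buchweitz approximation also has
finite injective dimension, so its embedding into a power of `ω` splits and `X` is a quotient of
some `ω^n`. Take `n` minimal. The kernel `K` is again a quotient of a power of `ω`, by a matrix of
scalars; a unit entry would allow a smaller `n`, so `K ⊆ 𝔪 ω^n`.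

For `X = M ⊗ N`, the surjection `M^μ → M ⊗ N` given by generators of `N` lifts to `M^μ → ω^n`
because `Ext¹(M^μ, K) = 0`. By Nakayama the lift is surjective; compose it with a projection to `ω`.
-/

namespace LocalCM

open CategoryTheory Abelian IsLocalRing RingTheory.Sequence
open ModuleCat (of)

section AbelianCategory

universe w v

variable {C : Type v} [Category.{w} C] [Abelian C]

lemma injectiveDimension_lt_top_iff_exists_lt {Y : C} :
    injectiveDimension Y < ⊤ ↔ ∃ n, HasInjectiveDimensionLT Y n := by
  rw [lt_top_iff_ne_top, injectiveDimension_ne_top_iff]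
  exact ⟨fun ⟨n, h⟩ ↦ ⟨n + 1, h⟩, fun ⟨n, _⟩ ↦ ⟨n, hasInjectiveDimensionLT_of_ge Y n _ n.le_succ⟩⟩

variable {S : ShortComplex C}

lemma injectiveDimension_X₁_lt_top (hS : S.ShortExact) (h₂ : injectiveDimension S.X₂ < ⊤)
    (h₃ : injectiveDimension S.X₃ < ⊤) : injectiveDimension S.X₁ < ⊤ := by
  rw [injectiveDimension_lt_top_iff_exists_lt] at h₂ h₃ ⊢
  obtain ⟨⟨n, _⟩, ⟨m, _⟩⟩ := And.intro h₂ h₃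
  exact ⟨m + n + 1, hS.hasInjectiveDimensionLT_X₁ _
    (hasInjectiveDimensionLT_of_ge _ m _ (by lia)) (hasInjectiveDimensionLT_of_ge _ n _ (by lia))⟩

lemma injectiveDimension_X₂_lt_top (hS : S.ShortExact) (h₁ : injectiveDimension S.X₁ < ⊤)
    (h₃ : injectiveDimension S.X₃ < ⊤) : injectiveDimension S.X₂ < ⊤ := by
  rw [injectiveDimension_lt_top_iff_exists_lt] at h₁ h₃ ⊢
  obtain ⟨⟨n, _⟩, ⟨m, _⟩⟩ := And.intro h₁ h₃
  exact ⟨m + n, hS.hasInjectiveDimensionLT_X₂ _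
    (hasInjectiveDimensionLT_of_ge _ n _ (by lia)) (hasInjectiveDimensionLT_of_ge _ m _ (by lia))⟩

lemma injectiveDimension_X₃_lt_top (hS : S.ShortExact) (h₁ : injectiveDimension S.X₁ < ⊤)
    (h₂ : injectiveDimension S.X₂ < ⊤) : injectiveDimension S.X₃ < ⊤ := by
  rw [injectiveDimension_lt_top_iff_exists_lt] at h₁ h₂ ⊢
  obtain ⟨⟨n, _⟩, ⟨m, _⟩⟩ := And.intro h₁ h₂
  exact ⟨m + n, hS.hasInjectiveDimensionLT_X₃ _
    (hasInjectiveDimensionLT_of_ge _ m _ (by lia)) (hasInjectiveDimensionLT_of_ge _ n _ (by lia))⟩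

variable [HasExt.{w} C]

/-- The vanishing of all `Ext`-groups from `G` to `Y` in positive degrees. For `Y` a canonical
module, these are the objects that play the role of maximal Cohen-Macaulay modules. -/
def ExtOrthogonal (G Y : C) : Prop :=
  ∀ i, 0 < i → Subsingleton (Ext G Y i)

variable {G Y : C} {n : ℕ}

lemma subsingleton_ext_X₁ (hS : S.ShortExact) (h₂ : Subsingleton (Ext S.X₂ Y n))
    (h₃ : Subsingleton (Ext S.X₃ Y (n + 1))) : Subsingleton (Ext S.X₁ Y n) := by
  refine subsingleton_of_forall_eq 0 fun x ↦ ?_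
  obtain ⟨y, rfl⟩ := Ext.contravariant_sequence_exact₁ hS _ x (add_comm 1 n) (h₃.elim _ _)
  rw [h₂.elim y 0, Ext.comp_zero]

lemma subsingleton_ext_X₂ (hS : S.ShortExact) (h₁ : Subsingleton (Ext S.X₁ Y n))
    (h₃ : Subsingleton (Ext S.X₃ Y n)) : Subsingleton (Ext S.X₂ Y n) := by
  refine subsingleton_of_forall_eq 0 fun x ↦ ?_
  obtain ⟨y, rfl⟩ := Ext.contravariant_sequence_exact₂ hS _ x (h₁.elim _ _)
  rw [h₃.elim y 0, Ext.comp_zero]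

lemma subsingleton_ext_X₃ (hS : S.ShortExact) (h₁ : Subsingleton (Ext S.X₁ Y n))
    (h₂ : Subsingleton (Ext S.X₂ Y (n + 1))) : Subsingleton (Ext S.X₃ Y (n + 1)) := by
  refine subsingleton_of_forall_eq 0 fun x ↦ ?_
  obtain ⟨y, rfl⟩ := Ext.contravariant_sequence_exact₃ hS _ x (h₂.elim _ _) (add_comm 1 n)
  rw [h₁.elim y 0, Ext.comp_zero]

lemma subsingleton_ext_one_X₃ (hS : S.ShortExact) (h₂ : Subsingleton (Ext S.X₂ Y 1))
    (hext : ∀ φ : S.X₁ ⟶ Y, ∃ ψ : S.X₂ ⟶ Y, S.f ≫ ψ = φ) : Subsingleton (Ext S.X₃ Y 1) := by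
  refine subsingleton_of_forall_eq 0 fun x ↦ ?_
  obtain ⟨y, rfl⟩ := Ext.contravariant_sequence_exact₃ hS _ x (h₂.elim _ _) (add_zero 1)
  obtain ⟨φ, rfl⟩ := (Ext.mk₀_bijective _ _).2 y
  obtain ⟨ψ, rfl⟩ := hext φ
  rw [← Ext.mk₀_comp_mk₀]
  exact hS.extClass_comp_assoc _

lemma ExtOrthogonal.X₁ (hS : S.ShortExact) (h₂ : ExtOrthogonal S.X₂ Y)
    (h₃ : ExtOrthogonal S.X₃ Y) : ExtOrthogonal S.X₁ Y :=
  fun i hi ↦ subsingleton_ext_X₁ hS (h₂ i hi) (h₃ (i + 1) i.succ_pos)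

lemma ExtOrthogonal.X₂ (hS : S.ShortExact) (h₁ : ExtOrthogonal S.X₁ Y)
    (h₃ : ExtOrthogonal S.X₃ Y) : ExtOrthogonal S.X₂ Y :=
  fun i hi ↦ subsingleton_ext_X₂ hS (h₁ i hi) (h₃ i hi)

lemma ExtOrthogonal.X₃ (hS : S.ShortExact) (h₁ : ExtOrthogonal S.X₁ Y)
    (h₂ : ExtOrthogonal S.X₂ Y) (hext : ∀ φ : S.X₁ ⟶ Y, ∃ ψ : S.X₂ ⟶ Y, S.f ≫ ψ = φ) :
    ExtOrthogonal S.X₃ Y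
  | 1, _ => subsingleton_ext_one_X₃ hS (h₂ 1 one_pos) hext
  | i + 2, _ => subsingleton_ext_X₃ hS (h₁ (i + 1) i.succ_pos) (h₂ (i + 2) (i + 1).succ_pos)

lemma subsingleton_ext_to_X₃ (hS : S.ShortExact) (h₂ : Subsingleton (Ext G S.X₂ n))
    (h₁ : Subsingleton (Ext G S.X₁ (n + 1))) : Subsingleton (Ext G S.X₃ n) := by
  refine subsingleton_of_forall_eq 0 fun x ↦ ?_
  obtain ⟨y, rfl⟩ := Ext.covariant_sequence_exact₃ _ hS x rfl (h₁.elim _ _)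
  rw [h₂.elim y 0, Ext.zero_comp]

lemma ExtOrthogonal.to_X₃ (hS : S.ShortExact) (h₁ : ExtOrthogonal G S.X₁)
    (h₂ : ExtOrthogonal G S.X₂) : ExtOrthogonal G S.X₃ :=
  fun i hi ↦ subsingleton_ext_to_X₃ hS (h₂ i hi) (h₁ (i + 1) i.succ_pos)

lemma ExtOrthogonal.of_projective [Projective G] : ExtOrthogonal G Y :=
  fun i hi ↦ HasProjectiveDimensionLT.subsingleton G 1 i hi Y

lemma exists_comp_eq_of_subsingleton_ext_one (hS : S.ShortExact)
    (h₃ : Subsingleton (Ext S.X₃ Y 1)) (φ : S.X₁ ⟶ Y) : ∃ ψ : S.X₂ ⟶ Y, S.f ≫ ψ = φ := by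
  obtain ⟨y, hy⟩ := Ext.contravariant_sequence_exact₁ hS _ (Ext.mk₀ φ) (add_zero 1) (h₃.elim _ _)
  obtain ⟨ψ, rfl⟩ := (Ext.mk₀_bijective _ _).2 y
  rw [Ext.mk₀_comp_mk₀] at hy
  exact ⟨ψ, (Ext.mk₀_bijective _ _).1 hy⟩

lemma exists_lift_of_subsingleton_ext_one (hS : S.ShortExact)
    (h₁ : Subsingleton (Ext G S.X₁ 1)) (φ : G ⟶ S.X₃) : ∃ ψ : G ⟶ S.X₂, ψ ≫ S.g = φ := by
  obtain ⟨y, hy⟩ := Ext.covariant_sequence_exact₃ _ hS (Ext.mk₀ φ) (zero_add 1) (h₁.elim _ _)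
  obtain ⟨ψ, rfl⟩ := (Ext.mk₀_bijective _ _).2 y
  rw [Ext.mk₀_comp_mk₀] at hy
  exact ⟨ψ, (Ext.mk₀_bijective _ _).1 hy⟩

end AbelianCategory

section ModuleExt

variable {R : Type u} [CommRing R]
variable {A B C Y : Type u} [AddCommGroup A] [Module R A] [AddCommGroup B] [Module R B]
  [AddCommGroup C] [Module R C] [AddCommGroup Y] [Module R Y]

lemma shortExact_of_exact {f : A →ₗ[R] B} {g : B →ₗ[R] C} (hf : Function.Injective f)
    (hfg : Function.Exact f g) (hg : Function.Surjective g) :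
    (ModuleCat.shortComplexOfCompEqZero f g hfg.linearMap_comp_eq_zero).ShortExact :=
  ModuleCat.shortComplex_shortExact _ hfg hf hg

lemma shortExact_mkQ_range {f : A →ₗ[R] B} (hf : Function.Injective f) :
    (ModuleCat.shortComplexOfCompEqZero f (LinearMap.range f).mkQ
      f.exact_map_mkQ_range.linearMap_comp_eq_zero).ShortExact :=
  shortExact_of_exact hf f.exact_map_mkQ_range (Submodule.mkQ_surjective _)

lemma sum_proj_comp_single_eq_id {ι : Type} [Fintype ι] [DecidableEq ι] :
    ∑ i, ModuleCat.ofHom (LinearMap.proj i) ≫ ModuleCat.ofHom (LinearMap.single R (fun _ ↦ A) i) =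
      𝟙 (of R (ι → A)) := by
  ext : 1
  exact LinearMap.ext fun x ↦ by simp [ModuleCat.hom_sum, Finset.univ_sum_single]

variable {ι : Type} [Finite ι]

lemma ExtOrthogonal.pi (h : ExtOrthogonal (of R A) (of R Y)) :
    ExtOrthogonal (of R (ι → A)) (of R Y) := by
  classical
  have := Fintype.ofFinite ι
  refine fun n hn ↦ subsingleton_of_forall_eq 0 fun x ↦ ?_
  rw [← Ext.mk₀_id_comp x, ← sum_proj_comp_single_eq_id, Ext.mk₀_sum, Ext.sum_comp]
  refine Finset.sum_eq_zero fun i _ ↦ ?_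
  rw [← Ext.mk₀_comp_mk₀_assoc, (h n hn).elim ((Ext.mk₀ _).comp x _) 0, Ext.comp_zero]

lemma injectiveDimension_pi_lt_top (h : injectiveDimension (of R A) < ⊤) :
    injectiveDimension (of R (ι → A)) < ⊤ := by
  classical
  have := Fintype.ofFinite ι
  rw [injectiveDimension_lt_top_iff_exists_lt] at h ⊢
  obtain ⟨n, _⟩ := h
  refine ⟨n, .mk fun i hi X x ↦ ?_⟩
  rw [← Ext.comp_mk₀_id x, ← sum_proj_comp_single_eq_id, Ext.mk₀_sum, Ext.comp_sum]
  refine Finset.sum_eq_zero fun j _ ↦ ?_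
  have := HasInjectiveDimensionLT.subsingleton (of R A) n i hi X
  rw [← Ext.mk₀_comp_mk₀, ← Ext.comp_assoc_of_second_deg_zero,
    this.elim (x.comp (Ext.mk₀ _) _) 0, Ext.zero_comp]

end ModuleExt

section ExtVanishing

variable {R : Type u} [CommRing R]
variable {A Y : Type u} [AddCommGroup A] [Module R A] [AddCommGroup Y] [Module R Y]

lemma exists_injective_residueField [IsLocalRing R] [Nontrivial A] [IsArtinian R A] :
    ∃ f : ResidueField R →ₗ[R] A, Function.Injective f := by
  obtain ⟨N, hN⟩ := IsAtomic.exists_atom (Submodule R A)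
  obtain ⟨m, hm, ⟨e⟩⟩ := isSimpleModule_iff_quot_maximal.mp (isSimpleModule_iff_isAtom.mpr hN)
  obtain rfl := eq_maximalIdeal hm
  let e' : ResidueField R ≃ₗ[R] N := e.symm
  exact ⟨N.subtype ∘ₗ e', N.subtype_injective.comp e'.injective⟩

lemma subsingleton_ext_of_linearEquiv {B : Type u} [AddCommGroup B] [Module R B] (e : A ≃ₗ[R] B)
    {n : ℕ} (h : Subsingleton (Ext (of R A) (of R Y) n)) :
    Subsingleton (Ext (of R B) (of R Y) n) := by
  refine subsingleton_of_forall_eq 0 fun x ↦ ?_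
  rw [← Ext.mk₀_id_comp x, ← e.toModuleIso.inv_hom_id, ← Ext.mk₀_comp_mk₀_assoc,
    h.elim ((Ext.mk₀ _).comp x _) 0, Ext.comp_zero]

variable [IsNoetherianRing R] [Module.Finite R A] [Module.Finite R Y]

lemma isArtinian_of_supportDim_le_zero (h : Module.supportDim R A ≤ 0) : IsArtinian R A := by
  let I := Module.annihilator R A
  rw [Module.supportDim_eq_ringKrullDim_quotient_annihilator] at h
  have : Ring.KrullDimLE 0 (R ⧸ I) := (Ring.krullDimLE_iff).mpr (by simpa using h)
  have : IsArtinianRing (R ⧸ I) := isArtinianRing_iff_krullDimLE_zero.mpr this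
  let : Module (R ⧸ I) A := Module.quotientAnnihilator
  have : IsScalarTower R (R ⧸ I) A := .of_algebraMap_smul fun _ _ ↦ rfl
  have : Module.Finite (R ⧸ I) A := .of_restrictScalars_finite R _ _
  exact isArtinian_of_surjective_algebraMap (Ideal.Quotient.mk_surjective (I := I))

variable [IsLocalRing R]

lemma isArtinian_quotient_of_length_eq_supportDim {rs : List R}
    (mem : ∀ r ∈ rs, r ∈ maximalIdeal R) (reg : IsWeaklyRegular A rs)
    (hlen : Module.supportDim R A = rs.length) :
    IsArtinian R (A ⧸ (Ideal.ofList rs • ⊤ : Submodule R A)) := by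
  have : Nontrivial A := by simp [← Module.supportDim_ne_bot_iff_nontrivial R, hlen]
  have hdim := Module.supportDim_add_length_eq_supportDim_of_isRegular rs
    (.of_isWeaklyRegular_of_mem_maximalIdeal _ mem reg)
  rw [hlen] at hdim
  exact isArtinian_of_supportDim_le_zero
    (ENat.WithBot.add_natCast_cancel.mp (hdim.trans (zero_add _).symm)).le

lemma subsingleton_ext_of_quotSMulTop {x : R} {n : ℕ} (hx : x ∈ maximalIdeal R)
    (reg : IsSMulRegular A x)
    (h : Subsingleton (Ext (of R (QuotSMulTop x A)) (of R Y) (n + 1))) :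
    Subsingleton (Ext (of R A) (of R Y) n) := by
  by_contra! hne
  refine Submodule.top_ne_pointwise_smul_of_mem_jacobson_annihilator (r := x)
    (maximalIdeal_le_jacobson (Module.annihilator R (Ext (of R A) (of R Y) n)) hx)
    (top_unique fun z _ ↦ ?_).symm
  have hcomp (y : Ext (of R A) (of R Y) n) :
      (Ext.mk₀ (x • 𝟙 (of R A))).comp y (zero_add n) = x • y := by
    rw [Ext.mk₀_smul, Ext.smul_comp, Ext.mk₀_id_comp]
  obtain ⟨y, rfl⟩ := Ext.contravariant_sequence_exact₁
    (IsSMulRegular.smulShortComplex_shortExact (M := of R A) reg) _ z (add_comm 1 n) (h.elim _ _)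
  exact (Submodule.mem_smul_pointwise_iff_exists _ _ _).mpr ⟨y, trivial, (hcomp y).symm⟩

lemma subsingleton_ext_of_residueField {n : ℕ}
    (hk : Subsingleton (Ext (of R (ResidueField R)) (of R Y) n))
    (hsucc : ∀ (C : Type u) [AddCommGroup C] [Module R C] [Module.Finite R C],
      Subsingleton (Ext (of R C) (of R Y) (n + 1)))
    (C : Type u) [AddCommGroup C] [Module R C] [hC : Module.Finite R C] :
    Subsingleton (Ext (of R C) (of R Y) n) := by
  induction hC using IsNoetherianRing.induction_on_isQuotientEquivQuotientPrime R with
  | subsingleton N =>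
    have := (ModuleCat.isZero_of_subsingleton (of R N)).hasProjectiveDimensionLT_zero
    exact HasProjectiveDimensionLT.subsingleton (of R N) 0 n n.zero_le _
  | quotient N p e =>
    refine subsingleton_ext_of_linearEquiv e.symm ?_
    by_cases hp : p.1 = maximalIdeal R
    · rw [hp]
      exact hk
    obtain ⟨x, hx, hxp⟩ : ∃ x ∈ maximalIdeal R, x ∉ p.1 := by
      by_contra! hle
      exact hp (le_antisymm (le_maximalIdeal p.2.ne_top) hle)
    refine subsingleton_ext_of_quotSMulTop hx ?_ (hsucc _)
    rw [isSMulRegular_iff_right_eq_zero_of_smul]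
    intro z hz
    rw [Algebra.smul_def, mul_eq_zero] at hz
    exact hz.resolve_left fun h ↦ hxp (Ideal.Quotient.eq_zero_iff_mem.mp h)
  | exact N₁ N₂ N₃ f g hf hg hfg h₁ h₃ =>
    exact subsingleton_ext_X₂ (shortExact_of_exact hf hfg hg) h₁ h₃

lemma subsingleton_ext_of_injective_residueField {d : ℕ}
    (hA : ∀ i, d < i → Subsingleton (Ext (of R A) (of R Y) i))
    {f : ResidueField R →ₗ[R] A} (hf : Function.Injective f)
    (hY : injectiveDimension (of R Y) < ⊤) (C : Type u) [AddCommGroup C] [Module R C]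
    [Module.Finite R C] {i : ℕ} (hi : d < i) :
    Subsingleton (Ext (of R C) (of R Y) i) := by
  obtain ⟨b, _⟩ := injectiveDimension_lt_top_iff_exists_lt.mp hY
  obtain hbi | hib := le_total b i
  · exact HasInjectiveDimensionLT.subsingleton (of R Y) b i hbi _
  · induction hib using Nat.decreasingInduction generalizing C with
    | self => exact HasInjectiveDimensionLT.subsingleton (of R Y) b b le_rfl _
    | of_succ i _ ih =>
      refine subsingleton_ext_of_residueField ?_ (fun C ↦ ih C (by lia)) C
      -- `Ext^i(A, Y) → Ext^i(k, Y) → Ext^{i+1}(A / k, Y)` is exact and its outer terms vanish.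
      exact subsingleton_ext_X₁ (shortExact_mkQ_range hf) (hA i hi) (ih _ (by lia))

lemma subsingleton_ext_of_length_eq_ringKrullDim {rs : List R}
    (mem : ∀ r ∈ rs, r ∈ maximalIdeal R) (reg : IsWeaklyRegular R rs)
    (hlen : ringKrullDim R = rs.length) (hY : injectiveDimension (of R Y) < ⊤)
    (C : Type u) [AddCommGroup C] [Module R C] [Module.Finite R C] {i : ℕ} (hi : rs.length < i) :
    Subsingleton (Ext (of R C) (of R Y) i) := by
  let A := R ⧸ (Ideal.ofList rs • ⊤ : Submodule R R)
  have reg' : IsRegular R rs := .of_isWeaklyRegular_of_mem_maximalIdeal _ mem reg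
  have : Nontrivial A := Submodule.Quotient.nontrivial_iff.mpr reg'.top_ne_smul.symm
  have : IsArtinian R A := isArtinian_quotient_of_length_eq_supportDim mem reg
    ((Module.supportDim_self_eq_ringKrullDim R).trans hlen)
  have : HasProjectiveDimensionLE (of R A) rs.length := by
    rw [← projectiveDimension_le_iff,
      ModuleCat.projectiveDimension_quotient_eq_add_length_of_isWeaklyRegular (of R R) rs reg mem,
      ModuleCat.projectiveDimension_eq_zero_of_projective, zero_add]
  obtain ⟨f, hf⟩ := exists_injective_residueField (R := R) (A := A)
  refine subsingleton_ext_of_injective_residueField (fun i hi ↦ ?_) hf hY C hi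
  exact HasProjectiveDimensionLT.subsingleton _ (rs.length + 1) i hi _

lemma subsingleton_ext_of_isWeaklyRegular {d n : ℕ}
    (h : ∀ (C : Type u) [AddCommGroup C] [Module R C] [Module.Finite R C] {i : ℕ}, d < i →
      Subsingleton (Ext (of R C) (of R Y) i)) {rs : List R}
    (mem : ∀ r ∈ rs, r ∈ maximalIdeal R) (reg : IsWeaklyRegular A rs) (hn : d < n + rs.length) :
    Subsingleton (Ext (of R A) (of R Y) n) := by
  induction rs generalizing A n with
  | nil => exact h A (by simpa using hn)
  | cons x rs ih =>
    rw [isWeaklyRegular_cons_iff] at reg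
    rw [List.forall_mem_cons] at mem
    rw [List.length_cons] at hn
    exact subsingleton_ext_of_quotSMulTop mem.1 reg.1 (ih mem.2 reg.2 (by lia))

end ExtVanishing

section Rees

variable {R : Type u} [CommRing R]
variable {D Ω : Type u} [AddCommGroup D] [Module R D] [AddCommGroup Ω] [Module R Ω]

lemma smul_ext_eq_zero_of_mem_annihilator {x : R} (hx : x ∈ Module.annihilator R D) {n : ℕ}
    (z : Ext (of R D) (of R Ω) n) : x • z = 0 := by
  have hid : x • 𝟙 (of R D) = 0 :=
    ModuleCat.hom_ext (LinearMap.ext (Module.mem_annihilator.mp hx))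
  rw [← Ext.mk₀_id_comp z, ← Ext.smul_comp, ← Ext.mk₀_smul, hid, Ext.mk₀_zero, Ext.zero_comp]

lemma bijective_postcomp_extClass {x : R} {n : ℕ} (reg : IsSMulRegular Ω x)
    (hx : x ∈ Module.annihilator R D) (hD : Subsingleton (Ext (of R D) (of R Ω) n)) :
    Function.Bijective ((IsSMulRegular.smulShortComplex_shortExact
      (M := of R Ω) reg).extClass.postcompOfLinear R (of R D) (rfl : n + 1 = n + 1)) := by
  have hS := IsSMulRegular.smulShortComplex_shortExact (M := of R Ω) reg
  refine ⟨(injective_iff_map_eq_zero _).mpr fun y hy ↦ ?_, fun z ↦ ?_⟩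
  · obtain ⟨w, rfl⟩ := Ext.covariant_sequence_exact₃ _ hS y rfl hy
    exact (congrArg (fun v ↦ Ext.comp v _ (add_zero n)) (hD.elim w 0)).trans
      (Ext.zero_comp _ _ _ _ _)
  · refine Ext.covariant_sequence_exact₁ _ hS z ?_ rfl
    exact (Ext.smul_eq_comp_mk₀ z x).symm.trans (smul_ext_eq_zero_of_mem_annihilator hx z)

lemma bijective_postcomp_mk₀_iso {X Y : ModuleCat.{u} R} (e : X ≅ Y) (Z : ModuleCat.{u} R) :
    Function.Bijective ((Ext.mk₀ e.hom).postcompOfLinear R Z (zero_add 0)) :=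
  Function.bijective_iff_has_inverse.mpr
    ⟨fun y ↦ y.comp (Ext.mk₀ e.inv) (zero_add 0), fun y ↦ by simp, fun y ↦ by simp⟩

variable [IsNoetherianRing R] [Module.Finite R Ω]

lemma subsingleton_ext_of_lt_length [Module.Finite R D] {rs : List R} (reg : IsRegular Ω rs)
    (hD : Ideal.ofList rs ≤ Module.annihilator R D) {i : ℕ} (hi : i < rs.length) :
    Subsingleton (Ext (of R D) (of R Ω) i) := by
  refine ModuleCat.subsingleton_ext_of_exists_isRegular (Ideal.ofList rs) (of R D) ?_ (of R Ω)
    reg.top_ne_smul.symm.lt_top rs (fun r hr ↦ Ideal.subset_span hr) reg i hi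
  rw [Module.support_eq_zeroLocus]
  exact PrimeSpectrum.zeroLocus_anti_mono hD

/-- The Rees isomorphism `Hom(D, Ω / xΩ) ≃ Ext^n(D, Ω)`, realized as the Yoneda product with one
fixed class, which makes it natural in `D`. -/
lemma exists_ext_bijective_postcomp {rs : List R} (reg : IsRegular Ω rs) :
    ∃ η : Ext (of R (Ω ⧸ (Ideal.ofList rs • ⊤ : Submodule R Ω))) (of R Ω) rs.length,
      ∀ (D : Type u) [AddCommGroup D] [Module R D] [Module.Finite R D],
        Ideal.ofList rs ≤ Module.annihilator R D →
        Function.Bijective (η.postcompOfLinear R (of R D) (zero_add _)) := by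
  induction rs generalizing Ω with
  | nil =>
    let e := Submodule.quotEquivOfEqBot (Ideal.ofList ([] : List R) • (⊤ : Submodule R Ω))
      (by rw [Ideal.ofList_nil, Submodule.bot_smul])
    exact ⟨Ext.mk₀ e.toModuleIso.hom, fun D _ _ _ _ ↦ bijective_postcomp_mk₀_iso e.toModuleIso _⟩
  | cons x rs ih =>
    obtain ⟨hx, reg'⟩ := (isRegular_cons_iff Ω x rs).mp reg
    obtain ⟨η, hη⟩ := ih reg'
    let e := Submodule.quotOfListConsSMulTopEquivQuotSMulTopInner Ω x rs
    let δ := (IsSMulRegular.smulShortComplex_shortExact (M := of R Ω) hx).extClass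
    refine ⟨(Ext.mk₀ e.toModuleIso.hom).comp (η.comp δ rfl) (zero_add _), fun D _ _ _ hD ↦ ?_⟩
    have hδ := bijective_postcomp_extClass hx (hD (Ideal.subset_span (List.mem_cons_self)))
      (subsingleton_ext_of_lt_length reg hD (by simp : rs.length < (x :: rs).length))
    have hη := hη D ((Ideal.span_mono fun _ ↦ List.mem_cons_of_mem x).trans hD)
    have he := bijective_postcomp_mk₀_iso (R := R) e.toModuleIso (of R D)
    refine (congrArg Function.Bijective (funext fun y ↦ ?_)).mpr (hδ.comp (hη.comp he))
    calc
      y.comp ((Ext.mk₀ e.toModuleIso.hom).comp (η.comp δ rfl) (zero_add _)) (zero_add _)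
      _ = (y.comp (Ext.mk₀ e.toModuleIso.hom) (zero_add 0)).comp (η.comp δ rfl) (zero_add _) :=
        (Ext.comp_assoc y _ _ (zero_add 0) (zero_add _) (by simp)).symm
      _ = ((y.comp (Ext.mk₀ e.toModuleIso.hom) (zero_add 0)).comp η (zero_add _)).comp δ rfl :=
        (Ext.comp_assoc _ η δ (zero_add _) rfl (by simp)).symm

end Rees

section InjectiveModulo

variable {R : Type u} [CommRing R]

/-- `B` is injective relative to the finite modules killed by the ideal `I`. If `B` is itself killed
by `I` and `R` is Noetherian, this says that `B` is an injective module over `R ⧸ I`; it is phrased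
over `R` in order to avoid a change of rings. -/
def IsInjectiveModulo (I : Ideal R) (B : Type u) [AddCommGroup B] [Module R B] : Prop :=
  ∀ ⦃C D : Type u⦄ [AddCommGroup C] [Module R C] [Module.Finite R C] [AddCommGroup D] [Module R D],
    I ≤ Module.annihilator R C → ∀ j : D →ₗ[R] C, Function.Injective j →
    ∀ φ : D →ₗ[R] B, ∃ ψ : C →ₗ[R] B, ψ ∘ₗ j = φ

lemma IsInjectiveModulo.exists_ne_zero [IsLocalRing R] {I : Ideal R}
    {B : Type u} [AddCommGroup B] [Module R B] (hB : IsInjectiveModulo I B)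
    {κ : ResidueField R →ₗ[R] B} (hκ : κ ≠ 0)
    {C : Type u} [AddCommGroup C] [Module R C] [Module.Finite R C] (hC : I ≤ Module.annihilator R C)
    {c : C} (hc : c ≠ 0) : ∃ f : C →ₗ[R] B, f c ≠ 0 := by
  let t : R →ₗ[R] C := LinearMap.toSpanSingleton R C c
  have hle : LinearMap.ker t ≤ maximalIdeal R :=
    le_maximalIdeal ((Ideal.ne_top_iff_one _).mpr fun h ↦ hc (by simpa [t] using h))
  let π : (R ⧸ LinearMap.ker t) →ₗ[R] ResidueField R :=
    Submodule.mapQ (LinearMap.ker t) (maximalIdeal R) LinearMap.id hle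
  have hπ : Function.Surjective π := fun a ↦ by
    obtain ⟨r, rfl⟩ := residue_surjective a
    exact ⟨Submodule.Quotient.mk r, rfl⟩
  obtain ⟨ψ, hψ⟩ := hB hC ((LinearMap.ker t).liftQ t le_rfl)
    (LinearMap.ker_eq_bot.mp (Submodule.ker_liftQ_eq_bot _ _ _ le_rfl)) (κ ∘ₗ π)
  refine ⟨ψ, fun h0 ↦ hκ ((LinearMap.cancel_right hπ).mp ?_)⟩
  rw [← hψ, LinearMap.zero_comp]
  refine Submodule.linearMap_qext _ (LinearMap.ext_ring ((congrArg ψ ?_).trans h0))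
  exact one_smul R c

variable {Ω : Type u} [AddCommGroup Ω] [Module R Ω] [IsNoetherianRing R] [Module.Finite R Ω]
  {rs : List R}

lemma isInjectiveModulo_quotient (reg : IsRegular Ω rs)
    (hΩ : ∀ (C : Type u) [AddCommGroup C] [Module R C] [Module.Finite R C],
      Subsingleton (Ext (of R C) (of R Ω) (rs.length + 1))) :
    IsInjectiveModulo (Ideal.ofList rs) (Ω ⧸ (Ideal.ofList rs • ⊤ : Submodule R Ω)) := by
  intro C D _ _ _ _ _ hC j hj φ
  have : Module.Finite R D := .of_injective j hj
  obtain ⟨η, hη⟩ := exists_ext_bijective_postcomp reg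
  obtain ⟨z, hz⟩ := Ext.contravariant_sequence_exact₁ (shortExact_mkQ_range hj) _
    ((Ext.mk₀ (ModuleCat.ofHom φ)).comp η (zero_add _)) (add_comm 1 _) ((hΩ _).elim _ _)
  obtain ⟨y, rfl⟩ := (hη C hC).2 z
  obtain ⟨ψ, rfl⟩ := (Ext.mk₀_bijective _ _).2 y
  refine ⟨ψ.hom, ?_⟩
  have hcomp : ((Ext.mk₀ (ModuleCat.ofHom j)).comp (Ext.mk₀ ψ) (zero_add 0)).comp η (zero_add _) =
      (Ext.mk₀ (ModuleCat.ofHom φ)).comp η (zero_add _) :=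
    (Ext.comp_assoc_of_second_deg_zero ..).trans hz
  have := (hη D (hC.trans (j.annihilator_le_of_injective hj))).1 hcomp
  rw [Ext.mk₀_comp_mk₀] at this
  exact congrArg ModuleCat.Hom.hom ((Ext.mk₀_bijective _ _).1 this)

lemma length_ext_eq_length_hom (reg : IsRegular Ω rs)
    {D : Type u} [AddCommGroup D] [Module R D] [Module.Finite R D]
    (hD : Ideal.ofList rs ≤ Module.annihilator R D) :
    Module.length R (Ext (of R D) (of R Ω) rs.length) =
      Module.length R (D →ₗ[R] Ω ⧸ (Ideal.ofList rs • ⊤ : Submodule R Ω)) := by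
  obtain ⟨η, hη⟩ := exists_ext_bijective_postcomp reg
  exact ((LinearEquiv.ofBijective _ (hη D hD)).symm ≪≫ₗ Ext.linearEquiv₀ ≪≫ₗ
    ModuleCat.homLinearEquiv).length_eq

end InjectiveModulo

section Reduction

open scoped Pointwise

variable {R : Type u} [CommRing R]
variable {G Ω : Type u} [AddCommGroup G] [Module R G] [AddCommGroup Ω] [Module R Ω]

lemma mk_mem_smul_top_iff {I : Ideal R} {p : Submodule R G} {g : G} :
    p.mkQ g ∈ (I • ⊤ : Submodule R (G ⧸ p)) ↔ g ∈ p ⊔ I • (⊤ : Submodule R G) := by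
  rw [← Submodule.comap_map_mkQ, Submodule.map_smul'', Submodule.map_top, Submodule.range_mkQ,
    Submodule.mem_comap]

lemma mk_mem_ofList_smul_top_iff {x : R} {rs : List R} {g : G} :
    (Submodule.Quotient.mk g : QuotSMulTop x G) ∈ (Ideal.ofList rs • ⊤ : Submodule R _) ↔
      g ∈ (Ideal.ofList (x :: rs) • ⊤ : Submodule R G) := by
  rw [Ideal.ofList_cons, Submodule.sup_smul, Submodule.ideal_span_singleton_smul]
  exact mk_mem_smul_top_iff

lemma ExtOrthogonal.exists_mkQ_comp_eq {rs : List R} (hG : ExtOrthogonal (of R G) (of R Ω))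
    (reg : IsWeaklyRegular Ω rs) (φ : G →ₗ[R] Ω ⧸ (Ideal.ofList rs • ⊤ : Submodule R Ω)) :
    ∃ ψ : G →ₗ[R] Ω, Submodule.mkQ _ ∘ₗ ψ = φ := by
  induction rs generalizing Ω with
  | nil =>
    let e := Submodule.quotEquivOfEqBot (Ideal.ofList ([] : List R) • (⊤ : Submodule R Ω))
      (by rw [Ideal.ofList_nil, Submodule.bot_smul])
    exact ⟨e ∘ₗ φ, LinearMap.ext fun g ↦ e.symm_apply_apply (φ g)⟩
  | cons x rs ih =>
    rw [isWeaklyRegular_cons_iff] at reg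
    have hS := IsSMulRegular.smulShortComplex_shortExact (M := of R Ω) reg.1
    let e := Submodule.quotOfListConsSMulTopEquivQuotSMulTopInner Ω x rs
    obtain ⟨φ', hφ'⟩ := ih (Ω := QuotSMulTop x Ω) (hG.to_X₃ hS hG) reg.2 (e ∘ₗ φ)
    obtain ⟨ψ, hψ⟩ := exists_lift_of_subsingleton_ext_one hS (hG 1 one_pos) (ModuleCat.ofHom φ')
    obtain rfl : Submodule.mkQ _ ∘ₗ ψ.hom = φ' := congrArg ModuleCat.Hom.hom hψ
    exact ⟨ψ.hom, LinearMap.ext fun g ↦ e.injective (LinearMap.congr_fun hφ' g)⟩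

variable [IsLocalRing R] [IsNoetherianRing R] [Module.Finite R G]

lemma eq_zero_of_forall_quotSMulTop_map_eq_zero {ι : Type*} {x : R} (hx : x ∈ maximalIdeal R)
    (reg : IsSMulRegular Ω x) {f : ι → G →ₗ[R] Ω}
    (hf : ∀ g, (∀ i, QuotSMulTop.map x (f i) g = 0) → g = 0) {g : G} (hg : ∀ i, f i g = 0) :
    g = 0 := by
  let K : Submodule R G := ⨅ i, LinearMap.ker (f i)
  have hK : K = ⊥ := by
    refine Submodule.eq_bot_of_le_smul_of_le_jacobson_bot (maximalIdeal R) K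
      (IsNoetherian.noetherian K) (fun g hg ↦ ?_) (maximalIdeal_le_jacobson _)
    simp only [K, Submodule.mem_iInf, LinearMap.mem_ker] at hg
    obtain ⟨g', -, rfl⟩ := (Submodule.mem_smul_pointwise_iff_exists _ _ _).mp
      ((Submodule.Quotient.mk_eq_zero _).mp
        (hf (Submodule.Quotient.mk g) fun i ↦ congrArg Submodule.Quotient.mk (hg i)))
    refine Submodule.smul_mem_smul hx ?_
    simp only [K, Submodule.mem_iInf, LinearMap.mem_ker]
    exact fun i ↦ reg.right_eq_zero_of_smul ((map_smul (f i) x g').symm.trans (hg i))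
  have : g ∈ K := by simpa [K] using hg
  rwa [hK, Submodule.mem_bot] at this

lemma eq_zero_of_forall_apply_eq_zero_of_ofList {ι : Type*} {rs : List R}
    (mem : ∀ r ∈ rs, r ∈ maximalIdeal R) (reg : IsWeaklyRegular Ω rs) {f : ι → G →ₗ[R] Ω}
    (hf : ∀ g, (∀ i, f i g ∈ (Ideal.ofList rs • ⊤ : Submodule R Ω)) →
      g ∈ (Ideal.ofList rs • ⊤ : Submodule R G)) {g : G} (hg : ∀ i, f i g = 0) : g = 0 := by
  induction rs generalizing G Ω with
  | nil => simpa using hf g (by simpa using hg)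
  | cons x rs ih =>
    rw [isWeaklyRegular_cons_iff] at reg
    rw [List.forall_mem_cons] at mem
    refine eq_zero_of_forall_quotSMulTop_map_eq_zero mem.1 reg.1 (fun g ↦ ?_) hg
    refine ih mem.2 reg.2 fun g h ↦ ?_
    obtain ⟨g, rfl⟩ := Submodule.mkQ_surjective _ g
    exact mk_mem_ofList_smul_top_iff.mpr (hf g fun i ↦ mk_mem_ofList_smul_top_iff.mp (h i))

variable [Module.Finite R Ω]

lemma eq_top_of_forall_exists_mkQ_comp_eq {x : R} (hx : x ∈ maximalIdeal R)
    (reg : IsSMulRegular Ω x) {N : Submodule R (G →ₗ[R] Ω)}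
    (hN : ∀ φ : G →ₗ[R] QuotSMulTop x Ω, ∃ ψ ∈ N, Submodule.mkQ _ ∘ₗ ψ = φ) : N = ⊤ := by
  refine top_unique (Submodule.le_of_le_smul_of_le_jacobson_bot Module.Finite.fg_top
    (maximalIdeal_le_jacobson _) fun φ _ ↦ ?_)
  obtain ⟨ψ, hψ, hφψ⟩ := hN (Submodule.mkQ _ ∘ₗ φ)
  have hdvd : ∀ g, ∃ w, x • w = (φ - ψ) g := fun g ↦ by
    have hg : Submodule.mkQ (x • (⊤ : Submodule R Ω)) ((φ - ψ) g) = 0 := by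
      rw [LinearMap.sub_apply, map_sub, sub_eq_zero]
      exact (LinearMap.congr_fun hφψ g).symm
    exact (LinearMap.exact_lsmul_mkQ_smul_top Ω x _).mp hg
  choose χ hχ using hdvd
  let χ' : G →ₗ[R] Ω :=
    { toFun := χ
      map_add' a b := reg (by simp only [smul_add, hχ, map_add])
      map_smul' r a := reg (by simp only [smul_comm x, hχ, map_smul, RingHom.id_apply]) }
  have hφ : φ = ψ + x • χ' := by
    rw [← sub_eq_iff_eq_add']
    exact LinearMap.ext fun g ↦ (hχ g).symm
  rw [hφ]
  exact Submodule.add_mem_sup hψ (Submodule.smul_mem_smul hx trivial)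

lemma eq_top_of_forall_exists_mkQ_ofList_comp_eq {rs : List R}
    (mem : ∀ r ∈ rs, r ∈ maximalIdeal R) (reg : IsWeaklyRegular Ω rs) {N : Submodule R (G →ₗ[R] Ω)}
    (hN : ∀ φ : G →ₗ[R] Ω ⧸ (Ideal.ofList rs • ⊤ : Submodule R Ω),
      ∃ ψ ∈ N, Submodule.mkQ _ ∘ₗ ψ = φ) : N = ⊤ := by
  induction rs generalizing Ω with
  | nil =>
    refine top_unique fun φ _ ↦ ?_
    obtain ⟨ψ, hψ, hφψ⟩ := hN (Submodule.mkQ _ ∘ₗ φ)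
    have hφ : ψ = φ := LinearMap.ext fun g ↦ by
      simpa [Submodule.Quotient.eq, sub_eq_zero] using LinearMap.congr_fun hφψ g
    exact hφ ▸ hψ
  | cons x rs ih =>
    rw [isWeaklyRegular_cons_iff] at reg
    rw [List.forall_mem_cons] at mem
    let e := Submodule.quotOfListConsSMulTopEquivQuotSMulTopInner Ω x rs
    have htop := ih (N := N.map ((Submodule.mkQ (x • ⊤)).compRight R)) mem.2 reg.2 fun φ ↦ by
      obtain ⟨ψ, hψ, hφψ⟩ := hN (e.symm ∘ₗ φ)
      refine ⟨_, ⟨ψ, hψ, rfl⟩, LinearMap.ext fun g ↦ e.symm.injective ?_⟩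
      exact LinearMap.congr_fun hφψ g
    refine eq_top_of_forall_exists_mkQ_comp_eq mem.1 reg.1 fun φ ↦ ?_
    exact Submodule.eq_top_iff'.mp htop φ

end Reduction

section Length

variable {R : Type u} [CommRing R]
variable {A B W : Type u} [AddCommGroup A] [Module R A] [AddCommGroup B] [Module R B]
  [AddCommGroup W] [Module R W]

lemma surjective_of_injective_of_length_le [IsArtinian R B] [IsNoetherian R B] {f : A →ₗ[R] B}
    (hf : Function.Injective f) (h : Module.length R B ≤ Module.length R A) :
    Function.Surjective f := by
  rw [← LinearMap.range_eq_top]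
  by_contra hne
  exact (Submodule.length_lt hne).not_ge (h.trans_eq (LinearEquiv.ofInjective f hf).length_eq)

lemma length_hom_le_length_hom_quotient_add (N : Submodule R A) :
    Module.length R (A →ₗ[R] W) ≤
      Module.length R (A ⧸ N →ₗ[R] W) + Module.length R (N →ₗ[R] W) := by
  have hexact := LinearMap.exact_lcomp_of_exact_of_surjective W (LinearMap.exact_subtype_mkQ N)
    N.mkQ_surjective
  rw [Module.length_eq_add_of_exact (LinearMap.lcomp R W N.mkQ)
    (LinearMap.lcomp R W N.subtype).rangeRestrict
    (LinearMap.lcomp_injective_of_surjective _ N.mkQ_surjective)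
    (LinearMap.surjective_rangeRestrict _) fun φ ↦ Subtype.ext_iff.trans (hexact φ)]
  gcongr
  exact Module.length_le_of_injective _ (Submodule.subtype_injective _)

variable [IsLocalRing R]

lemma length_hom_le_length (hW : Module.length R (ResidueField R →ₗ[R] W) ≤ 1)
    (hA : IsFiniteLength R A) : Module.length R (A →ₗ[R] W) ≤ Module.length R A := by
  induction hA with
  | of_subsingleton => simp
  | @of_simple_quotient A _ _ N hN _ ih =>
    have hsimple : Module.length R (A ⧸ N →ₗ[R] W) ≤ Module.length R (A ⧸ N) := by
      obtain ⟨m, hm, ⟨e⟩⟩ := isSimpleModule_iff_quot_maximal.mp hN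
      rw [eq_maximalIdeal hm] at e
      rw [(LinearEquiv.congrLeft W R e).length_eq, Module.length_eq_one_iff.mpr hN]
      exact hW
    rw [Module.length_eq_add_of_exact N.subtype N.mkQ N.subtype_injective N.mkQ_surjective
      (LinearMap.exact_subtype_mkQ N), add_comm]
    exact (length_hom_le_length_hom_quotient_add N).trans (add_le_add hsimple ih)

lemma surjective_lsmul_of_length_hom_le_one [IsArtinian R W] [IsNoetherian R W]
    (hW : Module.length R (ResidueField R →ₗ[R] W) ≤ 1) :
    Function.Surjective (LinearMap.lsmul R W) := by
  have hker : LinearMap.ker (LinearMap.lsmul R W) = Module.annihilator R W := by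
    ext r
    simp [Module.mem_annihilator, LinearMap.ext_iff]
  let g : (R ⧸ Module.annihilator R W) →ₗ[R] (W →ₗ[R] W) :=
    Submodule.liftQ _ (LinearMap.lsmul R W) hker.ge
  have hg : Function.Injective g :=
    LinearMap.ker_eq_bot.mp (Submodule.ker_liftQ_eq_bot _ _ _ hker.le)
  have hflip : Function.Injective g.flip := fun v w h ↦ by
    have : (1 : R) • v = (1 : R) • w := LinearMap.congr_fun h (Submodule.Quotient.mk 1)
    rwa [one_smul, one_smul] at this
  have hend : Module.length R (W →ₗ[R] W) ≤ Module.length R W :=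
    length_hom_le_length hW (Module.length_ne_top_iff.mp Module.length_ne_top)
  have hfin : IsFiniteLength R (W →ₗ[R] W) :=
    Module.length_ne_top_iff.mp (ne_top_of_le_ne_top Module.length_ne_top hend)
  obtain ⟨_, _⟩ := isFiniteLength_iff_isNoetherian_isArtinian.mp hfin
  have hquot : Module.length R W ≤ Module.length R (R ⧸ Module.annihilator R W) :=
    (Module.length_le_of_injective _ hflip).trans (length_hom_le_length hW (hfin.of_injective hg))
  -- `ℓ(W) ≤ ℓ(R ⧸ ann W) ≤ ℓ(End W) ≤ ℓ(W)`, so the inclusion `R ⧸ ann W → End W` is onto.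
  have hgs := surjective_of_injective_of_length_le hg (hend.trans hquot)
  exact fun φ ↦ ((Submodule.mkQ_surjective _).exists.mp (hgs φ))

end Length

section CohenMacaulay

lemma exists_isWeaklyRegular_length_eq_depth {R : Type u} [CommRing R] [IsLocalRing R] {M : Type u}
    [AddCommGroup M] [Module R M] (h : depth R M < ⊤) :
    ∃ rs : List R, (∀ r ∈ rs, r ∈ maximalIdeal R) ∧ IsWeaklyRegular M rs ∧
      depth R M = rs.length := by
  have : Nonempty {rs : List R | (∀ r ∈ rs, r ∈ maximalIdeal R) ∧ IsWeaklyRegular M rs} :=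
    ⟨[], by simp, .nil R M⟩
  rw [depth, iSup_subtype'] at h ⊢
  obtain ⟨⟨rs, mem, reg⟩, heq⟩ := ENat.exists_eq_iSup_of_lt_top h
  exact ⟨rs, mem, reg, heq.symm⟩

lemma IsMaximalCohenMacaulay.nontrivial {R : Type u} [CommRing R] [IsLocalRing R] {M : Type u}
    [AddCommGroup M] [Module R M] (hM : IsMaximalCohenMacaulay R M) : Nontrivial M := by
  rw [← Module.supportDim_ne_bot_iff_nontrivial R, hM.dim_eq]
  exact ne_bot_of_le_ne_bot WithBot.zero_ne_bot ringKrullDim_nonneg_of_nontrivial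

lemma IsMaximalCohenMacaulay.exists_isRegular {R : Type u} [CommRing R] [IsLocalRing R]
    [IsNoetherianRing R] {M : Type u} [AddCommGroup M] [Module R M]
    (hM : IsMaximalCohenMacaulay R M) :
    ∃ rs : List R, (∀ r ∈ rs, r ∈ maximalIdeal R) ∧ IsRegular M rs ∧
      ringKrullDim R = rs.length ∧ depth R M = rs.length := by
  have := hM.finite
  have := hM.nontrivial
  have hdepth : ((depth R M : ℕ∞) : WithBot ℕ∞) = ringKrullDim R :=
    (hM.depth_eq.resolve_left (not_subsingleton M)).trans hM.dim_eq
  have hlt : depth R M < ⊤ :=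
    WithBot.coe_lt_coe.mp (hdepth.trans_lt (lt_top_iff_ne_top.mpr ringKrullDim_ne_top))
  obtain ⟨rs, mem, reg, hrs⟩ := exists_isWeaklyRegular_length_eq_depth hlt
  refine ⟨rs, mem, .of_isWeaklyRegular_of_mem_maximalIdeal _ mem reg, ?_, hrs⟩
  rw [← hdepth, hrs]
  rfl

variable {R : Type u} [CommRing R] [IsCohenMacaulayLocalRing R]

lemma subsingleton_ext_of_ringKrullDim_lt {Y : Type u} [AddCommGroup Y] [Module R Y]
    [Module.Finite R Y] (hY : injectiveDimension (of R Y) < ⊤)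
    (C : Type u) [AddCommGroup C] [Module R C] [Module.Finite R C] {i : ℕ}
    (hi : ringKrullDim R < i) : Subsingleton (Ext (of R C) (of R Y) i) := by
  have hR : IsMaximalCohenMacaulay R R :=
    ⟨IsCohenMacaulayLocalRing.isCohenMacaulay, Module.supportDim_self_eq_ringKrullDim R⟩
  obtain ⟨rs, mem, reg, hdim, -⟩ := hR.exists_isRegular
  rw [hdim] at hi
  exact subsingleton_ext_of_length_eq_ringKrullDim mem reg.1 hdim hY C (by exact_mod_cast hi)

lemma IsMaximalCohenMacaulay.extOrthogonal {M : Type u} [AddCommGroup M] [Module R M]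
    (hM : IsMaximalCohenMacaulay R M) {Y : Type u} [AddCommGroup Y] [Module R Y]
    [Module.Finite R Y] (hY : injectiveDimension (of R Y) < ⊤) :
    ExtOrthogonal (of R M) (of R Y) := by
  intro i hi
  have := hM.finite
  obtain ⟨rs, mem, reg, hdim, -⟩ := hM.exists_isRegular
  refine subsingleton_ext_of_isWeaklyRegular (d := rs.length) (fun C _ _ _ i hi ↦ ?_) mem reg.1
    (by simpa using hi)
  exact subsingleton_ext_of_ringKrullDim_lt hY C (by rw [hdim]; exact_mod_cast hi)

end CohenMacaulay

section CanonicalModule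

lemma ofList_le_annihilator_residueField {R : Type u} [CommRing R] [IsLocalRing R] {rs : List R}
    (mem : ∀ r ∈ rs, r ∈ maximalIdeal R) :
    Ideal.ofList rs ≤ Module.annihilator R (ResidueField R) :=
  (Ideal.span_le.mpr mem).trans_eq Ideal.annihilator_quotient.symm

lemma le_annihilator_quotient_smul_top {R : Type u} [CommRing R] (I : Ideal R) (M : Type u)
    [AddCommGroup M] [Module R M] :
    I ≤ Module.annihilator R (M ⧸ (I • ⊤ : Submodule R M)) := by
  intro r hr
  rw [Module.mem_annihilator]
  rintro ⟨m⟩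
  exact (Submodule.Quotient.mk_eq_zero _).mpr (Submodule.smul_mem_smul hr trivial)

section Lifting

variable {R : Type u} [CommRing R] [IsLocalRing R] [IsNoetherianRing R]
variable {Ω : Type u} [AddCommGroup Ω] [Module R Ω] {rs : List R}

lemma ExtOrthogonal.eq_zero_of_forall_apply_eq_zero {G : Type u} [AddCommGroup G] [Module R G]
    [Module.Finite R G] (hG : ExtOrthogonal (of R G) (of R Ω))
    (mem : ∀ r ∈ rs, r ∈ maximalIdeal R) (reg : IsWeaklyRegular Ω rs)
    (hinj : IsInjectiveModulo (Ideal.ofList rs) (Ω ⧸ (Ideal.ofList rs • ⊤ : Submodule R Ω)))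
    {κ : ResidueField R →ₗ[R] Ω ⧸ (Ideal.ofList rs • ⊤ : Submodule R Ω)} (hκ : κ ≠ 0) {g : G}
    (hg : ∀ f : G →ₗ[R] Ω, f g = 0) : g = 0 := by
  refine eq_zero_of_forall_apply_eq_zero_of_ofList mem reg (f := id) (fun g hg ↦ ?_) hg
  by_contra hne
  obtain ⟨f, hf⟩ := hinj.exists_ne_zero hκ (le_annihilator_quotient_smul_top (Ideal.ofList rs) G)
    ((Submodule.Quotient.mk_eq_zero _).not.mpr hne)
  obtain ⟨ψ, hψ⟩ := hG.exists_mkQ_comp_eq reg (f ∘ₗ Submodule.mkQ _)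
  refine hf ((LinearMap.congr_fun hψ g).symm.trans ?_)
  exact (Submodule.Quotient.mk_eq_zero _).mpr (hg ψ)

lemma surjective_lsmul_of_surjective_lsmul_quotient [Module.Finite R Ω]
    (mem : ∀ r ∈ rs, r ∈ maximalIdeal R) (reg : IsWeaklyRegular Ω rs)
    (h : Function.Surjective
      (LinearMap.lsmul R (Ω ⧸ (Ideal.ofList rs • ⊤ : Submodule R Ω)))) :
    Function.Surjective (LinearMap.lsmul R Ω) := by
  refine LinearMap.range_eq_top.mp (eq_top_of_forall_exists_mkQ_ofList_comp_eq mem reg fun φ ↦ ?_)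
  have hφ : (Ideal.ofList rs • ⊤ : Submodule R Ω) ≤ LinearMap.ker φ :=
    Submodule.smul_le.mpr fun r hr w _ ↦ by
      rw [LinearMap.mem_ker, map_smul]
      exact Module.mem_annihilator.mp (le_annihilator_quotient_smul_top _ Ω hr) (φ w)
  obtain ⟨r, hr⟩ := h (Submodule.liftQ _ φ hφ)
  refine ⟨LinearMap.lsmul R Ω r, ⟨r, rfl⟩, LinearMap.ext fun w ↦ ?_⟩
  exact LinearMap.congr_fun hr (Submodule.Quotient.mk w)

end Lifting

namespace IsCanonicalModule

variable {R : Type u} [CommRing R] [IsCohenMacaulayLocalRing R]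
variable {ω : Type u} [AddCommGroup ω] [Module R ω]

lemma exists_isRegular_isInjectiveModulo (hω : IsCanonicalModule R ω) :
    ∃ rs : List R, (∀ r ∈ rs, r ∈ maximalIdeal R) ∧ IsRegular ω rs ∧
      Module.supportDim R ω = rs.length ∧
      IsInjectiveModulo (Ideal.ofList rs) (ω ⧸ (Ideal.ofList rs • ⊤ : Submodule R ω)) ∧
      Module.length R (ResidueField R →ₗ[R] ω ⧸ (Ideal.ofList rs • ⊤ : Submodule R ω)) = 1 := by
  have := hω.finite
  obtain ⟨rs, mem, reg, hdim, hdepth⟩ := hω.toIsMaximalCohenMacaulay.exists_isRegular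
  refine ⟨rs, mem, reg, hω.dim_eq.trans hdim, isInjectiveModulo_quotient reg fun C _ _ _ ↦ ?_, ?_⟩
  · refine subsingleton_ext_of_ringKrullDim_lt hω.injectiveDimension_lt C ?_
    rw [hdim]
    exact_mod_cast rs.length.lt_succ_self
  · rw [← length_ext_eq_length_hom reg (ofList_le_annihilator_residueField mem), ← hω.type_eq, type,
      hdepth, ENat.toNat_natCast]

lemma eq_zero_of_forall_apply_eq_zero (hω : IsCanonicalModule R ω) {G : Type u} [AddCommGroup G]
    [Module R G] [Module.Finite R G] (hG : ExtOrthogonal (of R G) (of R ω)) {g : G}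
    (hg : ∀ f : G →ₗ[R] ω, f g = 0) : g = 0 := by
  obtain ⟨rs, mem, reg, -, hinj, hk⟩ := hω.exists_isRegular_isInjectiveModulo
  have := Module.length_pos_iff.mp (hk ▸ one_pos)
  obtain ⟨κ, hκ⟩ := exists_ne (0 : ResidueField R →ₗ[R] ω ⧸ (Ideal.ofList rs • ⊤ : Submodule R ω))
  exact hG.eq_zero_of_forall_apply_eq_zero mem reg.1 hinj hκ hg

lemma surjective_lsmul (hω : IsCanonicalModule R ω) :
    Function.Surjective (LinearMap.lsmul R ω) := by
  have := hω.finite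
  obtain ⟨rs, mem, reg, hdim, -, hk⟩ := hω.exists_isRegular_isInjectiveModulo
  have := isArtinian_quotient_of_length_eq_supportDim mem reg.1 hdim
  exact surjective_lsmul_of_surjective_lsmul_quotient mem reg.1
    (surjective_lsmul_of_length_hom_le_one hk.le)

lemma extOrthogonal_self (hω : IsCanonicalModule R ω) : ExtOrthogonal (of R ω) (of R ω) :=
  have := hω.finite
  hω.toIsMaximalCohenMacaulay.extOrthogonal hω.injectiveDimension_lt

end IsCanonicalModule

end CanonicalModule

section Pushout

variable {R : Type u} [CommRing R]
variable {A B C X : Type u} [AddCommGroup A] [Module R A] [AddCommGroup B] [Module R B]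
  [AddCommGroup C] [Module R C] [AddCommGroup X] [Module R X]

/-- The pushout of the linear maps `f : A → B` and `g : A → C`, realized as the quotient of `B × C`
by the antidiagonal image of `A`. -/
abbrev Pushout (f : A →ₗ[R] B) (g : A →ₗ[R] C) : Type u :=
  (B × C) ⧸ LinearMap.range (f.prod (-g))

namespace Pushout

variable (f : A →ₗ[R] B) (g : A →ₗ[R] C)

/-- The canonical map from the first summand to the pushout. -/
def inl : B →ₗ[R] Pushout f g :=
  Submodule.mkQ _ ∘ₗ LinearMap.inl R B C

/-- The canonical map from the second summand to the pushout. -/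
def inr : C →ₗ[R] Pushout f g :=
  Submodule.mkQ _ ∘ₗ LinearMap.inr R B C

variable {f g}

/-- The map out of the pushout induced by two maps that agree on `A`. -/
def desc (p : B →ₗ[R] X) (q : C →ₗ[R] X) (h : p ∘ₗ f = q ∘ₗ g) : Pushout f g →ₗ[R] X :=
  Submodule.liftQ _ (p.coprod q) <| by
    rintro _ ⟨a, rfl⟩
    simpa [sub_eq_zero, ← sub_eq_add_neg] using LinearMap.congr_fun h a

lemma mk_eq_inl_add_inr (b : B) (c : C) :
    (Submodule.Quotient.mk (b, c) : Pushout f g) = inl f g b + inr f g c := by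
  rw [inl, inr, LinearMap.comp_apply, LinearMap.comp_apply, ← map_add]
  simp

lemma exists_inl_add_inr_eq (y : Pushout f g) : ∃ b c, inl f g b + inr f g c = y := by
  obtain ⟨⟨b, c⟩, rfl⟩ := Submodule.Quotient.mk_surjective _ y
  exact ⟨b, c, (mk_eq_inl_add_inr b c).symm⟩

lemma inl_add_inr_eq_zero_iff {b : B} {c : C} :
    inl f g b + inr f g c = 0 ↔ ∃ a, f a = b ∧ -g a = c := by
  rw [← mk_eq_inl_add_inr, Submodule.Quotient.mk_eq_zero]
  exact exists_congr fun a ↦ Prod.ext_iff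

lemma inl_apply_eq_inr_apply (a : A) : inl f g (f a) = inr f g (g a) := by
  rw [← sub_eq_zero, sub_eq_add_neg, ← map_neg, inl_add_inr_eq_zero_iff]
  exact ⟨a, rfl, rfl⟩

section Desc

variable {p : B →ₗ[R] X} {q : C →ₗ[R] X} {h : p ∘ₗ f = q ∘ₗ g}

lemma desc_inl (b : B) : desc p q h (inl f g b) = p b := by
  simp [desc, inl]

lemma desc_inr (c : C) : desc p q h (inr f g c) = q c := by
  simp [desc, inr]

lemma desc_surjective_of_left (hp : Function.Surjective p) : Function.Surjective (desc p q h) :=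
  .of_comp (g := inl f g) <| by simpa [Function.comp_def, desc_inl] using hp

lemma desc_surjective_of_right (hq : Function.Surjective q) : Function.Surjective (desc p q h) :=
  .of_comp (g := inr f g) <| by simpa [Function.comp_def, desc_inr] using hq

end Desc

lemma inl_injective (hg : Function.Injective g) : Function.Injective (inl f g) := by
  refine (injective_iff_map_eq_zero _).mpr fun b hb ↦ ?_
  obtain ⟨a, rfl, ha⟩ := (inl_add_inr_eq_zero_iff (f := f) (g := g) (c := 0)).mp (by simpa using hb)
  rw [(map_eq_zero_iff g hg).mp (neg_eq_zero.mp ha), map_zero]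

lemma exact_comp_subtype_ker_inr :
    Function.Exact (g ∘ₗ (LinearMap.ker f).subtype) (inr f g) := by
  intro c
  have h := inl_add_inr_eq_zero_iff (f := f) (g := g) (b := 0) (c := c)
  rw [map_zero, zero_add] at h
  refine h.trans ⟨?_, ?_⟩
  · rintro ⟨a, ha, rfl⟩
    exact ⟨-⟨a, ha⟩, map_neg g a⟩
  · rintro ⟨a, rfl⟩
    exact ⟨-a.1, by simp, by simp⟩

lemma exact_inl_desc {q : C →ₗ[R] X} (hgq : Function.Exact g q) :
    Function.Exact (inl f g) (desc 0 q (by simp [hgq.linearMap_comp_eq_zero])) := by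
  refine fun y ↦ ⟨fun hy ↦ ?_, ?_⟩
  · obtain ⟨b, c, rfl⟩ := exists_inl_add_inr_eq y
    rw [map_add, desc_inl, desc_inr, LinearMap.zero_apply, zero_add] at hy
    obtain ⟨a, rfl⟩ := (hgq c).mp hy
    exact ⟨b + f a, by rw [map_add, inl_apply_eq_inr_apply]⟩
  · rintro ⟨b, rfl⟩
    exact desc_inl b

lemma exact_inr_desc {p : B →ₗ[R] X} (hfp : Function.Exact f p) :
    Function.Exact (inr f g) (desc p 0 (by simp [hfp.linearMap_comp_eq_zero])) := by
  refine fun y ↦ ⟨fun hy ↦ ?_, ?_⟩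
  · obtain ⟨b, c, rfl⟩ := exists_inl_add_inr_eq y
    rw [map_add, desc_inl, desc_inr, LinearMap.zero_apply, add_zero] at hy
    obtain ⟨a, rfl⟩ := (hfp b).mp hy
    exact ⟨g a + c, by rw [map_add, inl_apply_eq_inr_apply]⟩
  · rintro ⟨c, rfl⟩
    exact desc_inr c

lemma injectiveDimension_range_inr_lt_top (hg : Function.Injective g)
    (hf : injectiveDimension (of R (LinearMap.ker f)) < ⊤) (hC : injectiveDimension (of R C) < ⊤) :
    injectiveDimension (of R (LinearMap.range (inr f g))) < ⊤ := by
  have hexact : Function.Exact (g ∘ₗ (LinearMap.ker f).subtype) (inr f g).rangeRestrict := by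
    rw [LinearMap.exact_iff, LinearMap.ker_rangeRestrict]
    exact LinearMap.exact_iff.mp exact_comp_subtype_ker_inr
  have hinj : Function.Injective (g ∘ₗ (LinearMap.ker f).subtype) :=
    hg.comp (LinearMap.ker f).injective_subtype
  exact injectiveDimension_X₃_lt_top
    (shortExact_of_exact hinj hexact (LinearMap.surjective_rangeRestrict _)) hf hC

end Pushout

end Pushout

section Minimality

variable {R : Type u} [CommRing R]

lemma exists_surjective_pi_of_forall_exists_mem_ker {A X : Type u} [AddCommGroup A] [Module R A]
    [AddCommGroup X] [Module R X] {n : ℕ} {q : (Fin (n + 1) → A) →ₗ[R] X}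
    (hq : Function.Surjective q) (i : Fin (n + 1)) (h : ∀ a, ∃ v ∈ LinearMap.ker q, v i = a) :
    ∃ q' : (Fin n → A) →ₗ[R] X, Function.Surjective q' := by
  refine ⟨q ∘ₗ ∑ j, LinearMap.single R (fun _ ↦ A) (i.succAbove j) ∘ₗ LinearMap.proj j,
    fun x ↦ ?_⟩
  obtain ⟨v, rfl⟩ := hq x
  obtain ⟨w, hw, hwi⟩ := h (v i)
  have hv : v - w = ∑ j, Pi.single (i.succAbove j) ((v - w) (i.succAbove j)) := by
    conv_lhs => rw [← Finset.univ_sum_single (v - w), Fin.sum_univ_succAbove _ i]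
    simp [hwi]
  refine ⟨fun j ↦ (v - w) (i.succAbove j), ?_⟩
  rw [← sub_zero (q v), ← LinearMap.mem_ker.mp hw, ← map_sub]
  conv_rhs => rw [hv]
  simp

lemma surjective_of_surjective_comp_of_ker_le [IsLocalRing R] {G P X : Type u}
    [AddCommGroup G] [Module R G] [AddCommGroup P] [Module R P] [Module.Finite R P]
    [AddCommGroup X] [Module R X] {ψ : G →ₗ[R] P} {q : P →ₗ[R] X}
    (h : Function.Surjective (q ∘ₗ ψ)) (hq : LinearMap.ker q ≤ maximalIdeal R • ⊤) :
    Function.Surjective ψ := by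
  rw [← LinearMap.range_eq_top, eq_top_iff]
  refine Submodule.le_of_le_smul_of_le_jacobson_bot (I := maximalIdeal R)
    Module.Finite.fg_top (maximalIdeal_le_jacobson _) fun v _ ↦ ?_
  obtain ⟨a, ha⟩ := h (q v)
  rw [← add_sub_cancel (ψ a) v]
  exact Submodule.add_mem_sup ⟨a, rfl⟩ (hq (by simpa [sub_eq_zero] using ha.symm))

end Minimality

namespace IsCanonicalModule

variable {R : Type u} [CommRing R] [IsCohenMacaulayLocalRing R]
variable {ω : Type u} [AddCommGroup ω] [Module R ω]

section Approximation

lemma exists_injective_pi (hω : IsCanonicalModule R ω) {G : Type u} [AddCommGroup G] [Module R G]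
    [Module.Finite R G] (hG : ExtOrthogonal (of R G) (of R ω)) :
    ∃ (n : ℕ) (f : G →ₗ[R] (Fin n → ω)), Function.Injective f ∧
      ExtOrthogonal (of R ((Fin n → ω) ⧸ LinearMap.range f)) (of R ω) := by
  have := hω.finite
  obtain ⟨n, s, hs⟩ := Module.Finite.exists_fin (R := R) (M := G →ₗ[R] ω)
  have hspan (φ : G →ₗ[R] ω) : ∃ c : Fin n → R, ∑ i, c i • s i = φ :=
    (Submodule.mem_span_range_iff_exists_fun R).mp (hs ▸ trivial)
  have hinj : Function.Injective (LinearMap.pi s) := by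
    refine (injective_iff_map_eq_zero _).mpr fun g hg ↦ ?_
    refine hω.eq_zero_of_forall_apply_eq_zero hG fun φ ↦ ?_
    obtain ⟨c, rfl⟩ := hspan φ
    have hsg (i : Fin n) : s i g = 0 := congrFun hg i
    simp [hsg]
  refine ⟨n, LinearMap.pi s, hinj, hG.X₃ (shortExact_mkQ_range hinj) hω.extOrthogonal_self.pi ?_⟩
  intro φ
  obtain ⟨c, hc⟩ := hspan φ.hom
  refine ⟨ModuleCat.ofHom (∑ i, c i • LinearMap.proj i), ?_⟩
  ext g
  simp [← hc]

lemma extOrthogonal_of_injectiveDimension_lt_top (hω : IsCanonicalModule R ω)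
    {G : Type u} [AddCommGroup G] [Module R G] [Module.Finite R G]
    (hG : ExtOrthogonal (of R G) (of R ω)) {Y : Type u} [AddCommGroup Y] [Module R Y]
    [Module.Finite R Y] (hY : injectiveDimension (of R Y) < ⊤) :
    ExtOrthogonal (of R G) (of R Y) := by
  have := hω.finite
  obtain ⟨b, _⟩ := injectiveDimension_lt_top_iff_exists_lt.mp hY
  suffices H : ∀ (j i : ℕ), 0 < i → b ≤ i + j → ∀ (G : Type u) [AddCommGroup G] [Module R G]
      [Module.Finite R G], ExtOrthogonal (of R G) (of R ω) →
      Subsingleton (Ext (of R G) (of R Y) i) from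
    fun i hi ↦ H b i hi (by simp) G hG
  intro j
  induction j with
  | zero => exact fun i _ hi G _ _ _ _ ↦ HasInjectiveDimensionLT.subsingleton _ b i hi _
  | succ j ih =>
    intro i hi hij G _ _ _ hG
    obtain ⟨n, f, hf, hC⟩ := hω.exists_injective_pi hG
    have hωY := hω.toIsMaximalCohenMacaulay.extOrthogonal hY
    exact subsingleton_ext_X₁ (shortExact_mkQ_range hf) (hωY.pi i hi)
      (ih (i + 1) i.succ_pos (by lia) _ hC)

lemma exists_surjective_extOrthogonal_of_ker (hω : IsCanonicalModule R ω)
    {E P X : Type u} [AddCommGroup E] [Module R E] [Module.Finite R E] [AddCommGroup P]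
    [Module R P] [Module.Finite R P] [AddCommGroup X] [Module R X]
    (hE : ExtOrthogonal (of R E) (of R ω)) (hP : ExtOrthogonal (of R P) (of R ω))
    {p : P →ₗ[R] X} (hp : Function.Surjective p) {e : E →ₗ[R] LinearMap.ker p}
    (he : Function.Surjective e) (hker : injectiveDimension (of R (LinearMap.ker e)) < ⊤) :
    ∃ (E' : ModuleCat.{u} R) (p' : E' →ₗ[R] X), Module.Finite R E' ∧
      ExtOrthogonal E' (of R ω) ∧ Function.Surjective p' ∧
      injectiveDimension (of R (LinearMap.ker p')) < ⊤ := by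
  have := hω.finite
  obtain ⟨n, f, hf, hC⟩ := hω.exists_injective_pi hE
  let e' : E →ₗ[R] P := (LinearMap.ker p).subtype ∘ₗ e
  have hexact : Function.Exact e' p := by
    rw [LinearMap.exact_iff, LinearMap.range_comp, LinearMap.range_eq_top.mpr he]
    simp
  have hPω : ExtOrthogonal (of R (Pushout e' f)) (of R ω) :=
    ExtOrthogonal.X₂ (shortExact_of_exact (Pushout.inl_injective hf)
      (Pushout.exact_inl_desc f.exact_map_mkQ_range)
      (Pushout.desc_surjective_of_right (Submodule.mkQ_surjective _))) hP hC
  refine ⟨of R (Pushout e' f), Pushout.desc p 0 (by simp [hexact.linearMap_comp_eq_zero]),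
    inferInstance, hPω, Pushout.desc_surjective_of_left hp, ?_⟩
  rw [LinearMap.exact_iff.mp (Pushout.exact_inr_desc hexact)]
  refine Pushout.injectiveDimension_range_inr_lt_top hf ?_
    (injectiveDimension_pi_lt_top hω.injectiveDimension_lt)
  rwa [LinearMap.ker_comp_of_ker_eq_bot _ (Submodule.ker_subtype _)]

/-- The Auslander-Buchweitz approximation, by induction on the degree above which `Ext(X, ω)`
vanishes: approximate a syzygy of `X`, embed the approximation into a power of `ω`, and push out. -/
lemma exists_surjective_extOrthogonal (hω : IsCanonicalModule R ω) (X : Type u) [AddCommGroup X]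
    [Module R X] [Module.Finite R X] :
    ∃ (E : ModuleCat.{u} R) (p : E →ₗ[R] X), Module.Finite R E ∧ ExtOrthogonal E (of R ω) ∧
      Function.Surjective p ∧ injectiveDimension (of R (LinearMap.ker p)) < ⊤ := by
  obtain ⟨b, hX⟩ : ∃ b, ∀ i, b < i → Subsingleton (Ext (of R X) (of R ω) i) := by
    obtain ⟨b, _⟩ := injectiveDimension_lt_top_iff_exists_lt.mp hω.injectiveDimension_lt
    exact ⟨b, fun i hi ↦ HasInjectiveDimensionLT.subsingleton _ b i hi.le _⟩
  induction b generalizing X with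
  | zero =>
    refine ⟨of R X, LinearMap.id, ‹_›, hX, Function.surjective_id, ?_⟩
    rw [LinearMap.ker_id, injectiveDimension_lt_top_iff_exists_lt]
    have : Subsingleton (of R (⊥ : Submodule R X)) :=
      inferInstanceAs (Subsingleton (⊥ : Submodule R X))
    exact ⟨0, (ModuleCat.isZero_of_subsingleton _).hasInjectiveDimensionLT_zero⟩
  | succ b ih =>
    obtain ⟨m, p, hp⟩ := Module.Finite.exists_fin' R X
    obtain ⟨E, e, _, hE, he, hker⟩ := ih (LinearMap.ker p) fun i hi ↦
      subsingleton_ext_X₁ (LinearMap.shortExact_shortComplexKer hp)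
        (ExtOrthogonal.of_projective i (b.zero_le.trans_lt hi)) (hX (i + 1) (Nat.succ_lt_succ hi))
    exact hω.exists_surjective_extOrthogonal_of_ker hE .of_projective hp he hker

lemma exists_surjective_pi (hω : IsCanonicalModule R ω) {X : Type u} [AddCommGroup X]
    [Module R X] [Module.Finite R X] (hX : injectiveDimension (of R X) < ⊤) :
    ∃ (n : ℕ) (q : (Fin n → ω) →ₗ[R] X), Function.Surjective q := by
  have := hω.finite
  obtain ⟨E, p, _, hE, hp, hker⟩ := hω.exists_surjective_extOrthogonal X
  have hE' : injectiveDimension E < ⊤ :=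
    injectiveDimension_X₂_lt_top (LinearMap.shortExact_shortComplexKer hp) hker hX
  obtain ⟨n, f, hf, hC⟩ := hω.exists_injective_pi hE
  have hCE := hω.extOrthogonal_of_injectiveDimension_lt_top hC hE'
  obtain ⟨ρ, hρ⟩ := exists_comp_eq_of_subsingleton_ext_one (shortExact_mkQ_range hf)
    (hCE 1 one_pos) (𝟙 E)
  have hρf (x : E) : ρ.hom (f x) = x := LinearMap.congr_fun (congrArg ModuleCat.Hom.hom hρ) x
  exact ⟨n, p ∘ₗ ρ.hom, hp.comp fun x ↦ ⟨f x, hρf x⟩⟩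

end Approximation

section Minimality

lemma exists_surjective_proj_comp_or_range_le (hω : IsCanonicalModule R ω) {n : ℕ}
    (φ : ω →ₗ[R] (Fin n → ω)) :
    (∃ i, Function.Surjective (LinearMap.proj i ∘ₗ φ)) ∨
      LinearMap.range φ ≤ maximalIdeal R • ⊤ := by
  choose c hc using fun i ↦ hω.surjective_lsmul (LinearMap.proj i ∘ₗ φ)
  by_cases hcm : ∃ i, IsUnit (c i)
  · obtain ⟨i, hu⟩ := hcm
    refine .inl ⟨i, ?_⟩
    rw [← hc]
    exact ((Module.End.isUnit_iff _).mp (hu.map (algebraMap R (Module.End R ω)))).2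
  · rw [not_exists] at hcm
    right
    rintro _ ⟨w, rfl⟩
    rw [← Finset.univ_sum_single (φ w)]
    refine Submodule.sum_mem _ fun i _ ↦ ?_
    have hφ : φ w i = c i • w := (LinearMap.congr_fun (hc i) w).symm
    rw [hφ, Pi.single_smul]
    exact Submodule.smul_mem_smul (hcm i) trivial

lemma exists_surjective_pi_ker_le (hω : IsCanonicalModule R ω) {X : Type u} [AddCommGroup X]
    [Module R X] [Module.Finite R X] (hX : injectiveDimension (of R X) < ⊤) :
    ∃ (n : ℕ) (q : (Fin n → ω) →ₗ[R] X), Function.Surjective q ∧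
      LinearMap.ker q ≤ maximalIdeal R • ⊤ ∧ injectiveDimension (of R (LinearMap.ker q)) < ⊤ := by
  have := hω.finite
  obtain ⟨n, hn⟩ := exists_minimal_of_wellFoundedLT _ (hω.exists_surjective_pi hX)
  obtain ⟨q, hq⟩ := hn.prop
  have hker : injectiveDimension (of R (LinearMap.ker q)) < ⊤ :=
    injectiveDimension_X₁_lt_top (LinearMap.shortExact_shortComplexKer hq)
      (injectiveDimension_pi_lt_top hω.injectiveDimension_lt) hX
  obtain ⟨m, t, ht⟩ := hω.exists_surjective_pi hker
  refine ⟨n, q, hq, ?_, hker⟩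
  have hsup : LinearMap.ker q = ⨆ k, LinearMap.range
      ((LinearMap.ker q).subtype ∘ₗ t ∘ₗ LinearMap.single R (fun _ ↦ ω) k) := by
    simp only [LinearMap.range_comp, ← Submodule.map_iSup, LinearMap.iSup_range_single]
    simp [LinearMap.range_eq_top.mpr ht]
  rw [hsup]
  refine iSup_le fun k ↦ (hω.exists_surjective_proj_comp_or_range_le _).resolve_left ?_
  rintro ⟨i, hi⟩
  obtain ⟨n, rfl⟩ := Nat.exists_eq_succ_of_ne_zero i.pos.ne'
  refine hn.not_prop_of_lt n.lt_succ_self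
    (exists_surjective_pi_of_forall_exists_mem_ker hq i fun a ↦ ?_)
  obtain ⟨w, hw⟩ := hi a
  exact ⟨_, (t (LinearMap.single R (fun _ ↦ ω) k w)).2, hw⟩

lemma exists_surjective_of_surjective (hω : IsCanonicalModule R ω) {G X : Type u} [AddCommGroup G]
    [Module R G] [Module.Finite R G] [AddCommGroup X] [Module R X] [Nontrivial X]
    (hG : ExtOrthogonal (of R G) (of R ω)) (hX : injectiveDimension (of R X) < ⊤)
    {t : G →ₗ[R] X} (ht : Function.Surjective t) : ∃ f : G →ₗ[R] ω, Function.Surjective f := by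
  have := hω.finite
  have := Module.Finite.of_surjective t ht
  obtain ⟨n, q, hq, hle, hker⟩ := hω.exists_surjective_pi_ker_le hX
  obtain ⟨ψ, hψ⟩ := exists_lift_of_subsingleton_ext_one (LinearMap.shortExact_shortComplexKer hq)
    (hω.extOrthogonal_of_injectiveDimension_lt_top hG hker 1 one_pos) (ModuleCat.ofHom t)
  have hqψ : q ∘ₗ ψ.hom = t := congrArg ModuleCat.Hom.hom hψ
  have hψ' : Function.Surjective ψ.hom := surjective_of_surjective_comp_of_ker_le (hqψ ▸ ht) hle
  have hn : n ≠ 0 := by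
    rintro rfl
    exact not_subsingleton X hq.subsingleton
  have hproj := LinearMap.proj_surjective (R := R) (φ := fun _ ↦ ω)
    (⟨0, Nat.pos_of_ne_zero hn⟩ : Fin n)
  exact ⟨LinearMap.proj _ ∘ₗ ψ.hom, hproj.comp hψ'⟩

end Minimality

end IsCanonicalModule

section TensorProduct

variable (R : Type u) [CommRing R]

lemma exists_fin_mu_span_eq_top (N : Type u) [AddCommGroup N] [Module R N] [Module.Finite R N] :
    ∃ s : Fin (mu R N) → N, Submodule.span R (Set.range s) = ⊤ := by
  have hcard : (⊤ : Submodule R N).generators.ncard = mu R N :=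
    Submodule.FG.generators_ncard Module.Finite.fg_top
  have : Finite (⊤ : Submodule R N).generators :=
    Submodule.FG.finite_generators Module.Finite.fg_top
  let e := Finite.equivFinOfCardEq ((Nat.card_coe_set_eq _).trans hcard)
  refine ⟨Subtype.val ∘ e.symm, ?_⟩
  rw [e.symm.surjective.range_comp, Subtype.range_coe, Submodule.span_generators]

lemma exists_surjective_pi_tensorProduct (M : Type u) {N : Type u}
    [AddCommGroup M] [Module R M] [AddCommGroup N] [Module R N] {n : ℕ} {s : Fin n → N}
    (hs : Submodule.span R (Set.range s) = ⊤) :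
    ∃ t : (Fin n → M) →ₗ[R] M ⊗[R] N, Function.Surjective t := by
  refine ⟨∑ i, (TensorProduct.mk R M N).flip (s i) ∘ₗ LinearMap.proj i, ?_⟩
  rw [← LinearMap.range_eq_top, eq_top_iff, ← TensorProduct.span_tmul_eq_top, Submodule.span_le]
  rintro _ ⟨a, b, rfl⟩
  have hb : b ∈ Submodule.span R (Set.range s) := hs ▸ Submodule.mem_top
  obtain ⟨c, rfl⟩ := (Submodule.mem_span_range_iff_exists_fun R).mp hb
  exact ⟨fun i ↦ c i • a, by simp [TensorProduct.tmul_sum]⟩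

lemma nontrivial_tensorProduct [IsLocalRing R] (M N : Type u)
    [AddCommGroup M] [Module R M] [Module.Finite R M] [Nontrivial M]
    [AddCommGroup N] [Module R N] [Module.Finite R N] [Nontrivial N] :
    Nontrivial (M ⊗[R] N) := by
  have key (A : Type u) [AddCommGroup A] [Module R A] [Module.Finite R A] :
      Nontrivial (ResidueField R ⊗[R] A) ↔ Nontrivial A := by
    rw [← not_subsingleton_iff_nontrivial, subsingleton_tensorProduct,
      not_subsingleton_iff_nontrivial]
  have hM := (key M).mpr ‹_›
  have hN := (key N).mpr ‹_›
  rw [← key, (TensorProduct.AlgebraTensorModule.distribBaseChange R (ResidueField R) M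
    N).nontrivial_congr]
  infer_instance

end TensorProduct

end LocalCM

theorem mainTheorem6 (R : Type u) [CommRing R] [LocalCM.IsCohenMacaulayLocalRing R]
    (ω : Type u) [AddCommGroup ω] [Module R ω] (hω : LocalCM.IsCanonicalModule R ω)
    (M : Type u) [AddCommGroup M] [Module R M] [Module.Finite R M] [Nontrivial M]
    (N : Type u) [AddCommGroup N] [Module R N] [Module.Finite R N] [Nontrivial N]
    (hM : LocalCM.IsMaximalCohenMacaulay R M)
    (hid : CategoryTheory.injectiveDimension (ModuleCat.of R (M ⊗[R] N)) < ⊤) :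
    ∃ f : (Fin (LocalCM.mu R N) → M) →ₗ[R] ω, Function.Surjective f := by
  have := hω.finite
  have := LocalCM.nontrivial_tensorProduct R M N
  obtain ⟨s, hs⟩ := LocalCM.exists_fin_mu_span_eq_top R N
  obtain ⟨t, ht⟩ := LocalCM.exists_surjective_pi_tensorProduct R M hs
  exact hω.exists_surjective_of_surjective (hM.extOrthogonal hω.injectiveDimension_lt).pi hid ht
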